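/- Let $q,d\ge 2$ be integers. For $n\in\mathbb N=\{0,1,2,\dots\}$ let $v_q(0)=0$ and, for $n>0$, let $v_q(n)$ be the largest integer $k\ge 0$ such that $q^k$ divides $n$; put $w_q(n)=\sum_{i=0}^n v_q(i)$ and $u_q(n)=\sum_{i=0}^n w_q(i)$. For $\mathbf s=(\theta_u,\theta_w,\theta_2,\theta_1,\theta_0)\in\mathbb Z^5$ let $\gamma(N,q,d;\mathbf s)$ be the number of natural numbers $n<N$ with $$\theta_u u_q(n)+\theta_w w_q(n)+\theta_2\frac{n(n+1)}2+\theta_1 n+\theta_0\equiv 0 \pmod d,$$ and let $\delta(q,d;\mathbf s)=\lim_{N\to\infty}\gamma(N,q,d;\mathbf s)/N$ whenever this limit exists; it depends only on $\mathbf s$ modulo $d$. Then: (a) for all $\theta_w,\theta_1,\theta_0\in\mathbb Z$, the density $\delta(q,d;0,\theta_w,0,\theta_1,\theta_0)$ exists; (b) if $d$ divides $q^n$ for some $n\in\mathbb N$, then $\delta(q,d;\mathbf s)$ exists for every $\mathbf s\in\mathbb Z^5$, that is, the whole vector of densities $\boldsymbol\delta(q,d)=(\delta(q,d;\mathbf s))_{\mathbf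 s\in(\mathbb Z/d\mathbb Z)^5}$ exists. -/

import Mathlib

open Filter Topology

/-- `v_q(n)`: the largest `k` with `q ^ k ∣ n` if `n > 0`, and `0` if `n = 0`.
(`padicValNat` has this meaning for every base `q ≥ 2`, prime or not; see `vq_isGreatest`.) -/
def vq (q n : ℕ) : ℕ := padicValNat q n

theorem vq_zero (q : ℕ) : vq q 0 = 0 := by simp [vq]

theorem vq_isGreatest {q n : ℕ} (hq : 2 ≤ q) (hn : 0 < n) :
    IsGreatest {k : ℕ | q ^ k ∣ n} (vq q n) := by
  have hfin : FiniteMultiplicity q n := Nat.finiteMultiplicity_iff.2 ⟨by omega, hn⟩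
  have h : vq q n = multiplicity q n := padicValNat_def' (by omega) (by omega)
  rw [h]
  exact ⟨pow_multiplicity_dvd q n, fun k hk => hfin.le_multiplicity_of_pow_dvd hk⟩

/-- `w_q(n) = ∑_{i=0}^n v_q(i)`. -/
def wq (q n : ℕ) : ℕ := ∑ i ∈ Finset.range (n + 1), vq q i

/-- `u_q(n) = ∑_{i=0}^n w_q(i)`. -/
def uq (q n : ℕ) : ℕ := ∑ i ∈ Finset.range (n + 1), wq q i

/-- `n` solves `θ_u u_q(n) + θ_w w_q(n) + θ_2 n(n+1)/2 + θ_1 n + θ_0 ≡ 0 (mod d)`, where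
`s = (θ_u, θ_w, θ_2, θ_1, θ_0)`. The division by two is exact. -/
def IsSolution (q d : ℕ) (s : Fin 5 → ℤ) (n : ℕ) : Prop :=
  s 0 * (uq q n : ℤ) + s 1 * (wq q n : ℤ) + s 2 * ((n * (n + 1) / 2 : ℕ) : ℤ)
    + s 3 * (n : ℤ) + s 4 ≡ 0 [ZMOD (d : ℤ)]

instance (q d : ℕ) (s : Fin 5 → ℤ) : DecidablePred (IsSolution q d s) :=
  fun _ => inferInstanceAs (Decidable (Int.ModEq _ _ _))

/-- `γ(A, q, d; s)`: the number of natural numbers `n < A` that are solutions. -/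
def solutionCount (A q d : ℕ) (s : Fin 5 → ℤ) : ℕ :=
  ((Finset.range A).filter (IsSolution q d s)).card

/-- The density `δ(q, d; s) = lim_{N → ∞} γ(N, q, d; s) / N` exists and equals `δ`. -/
def HasSolutionDensity (q d : ℕ) (s : Fin 5 → ℤ) (δ : ℝ) : Prop :=
  Tendsto (fun N : ℕ => (solutionCount N q d s : ℝ) / (N : ℝ)) atTop (𝓝 δ)

/-- The vector of densities, indexed by `(ℤ/dℤ)^5`, exists and equals `δ`: every integer
coefficient vector has as its density the entry of `δ` at its residue class modulo `d`. -/
def HasDensityVector (q d : ℕ) (δ : (Fin 5 → ZMod d) → ℝ) : Prop :=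
  ∀ s : Fin 5 → ℤ, HasSolutionDensity q d s (δ (fun i => (s i : ZMod d)))

/-! ### Densities of sequences generated by a synchronizing digit automaton -/

/-! Modulo `d`, the pair (w, n), and likewise the quadruple (u, n(n+1)/2, w, n), at `q * n + r`
depends only on its value at `n` and on `r`. Base-`q` digits thus drive a finite automaton. If every
state can return to the initial one, some `K` serves all states: each block of length `q ^ K` meets
the initial state. Averaging over such blocks shrinks the spread of block means by the factor 1 -
1/q^K, so block means become nearly constant and the density exists
(`exists_density_of_digit_automaton`). Returns: for (w, n), write `n` down `d` times
(`linearState_return`). For the quadruple, return (w, n) to zero and then append zeros, which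
multiply the other two residues by powers of `q` until `d` kills them (`fullState_return`). -/

theorem sum_range_mul_eq_sum_blocks (f : ℕ → ℝ) (Q R : ℕ) :
    ∑ i ∈ Finset.range (Q * R), f i
      = ∑ j ∈ Finset.range R, ∑ b ∈ Finset.range Q, f (Q * j + b) := by
  induction R with
  | zero => simp
  | succ R ih => rw [Nat.mul_succ, Finset.sum_range_add, ih, Finset.sum_range_succ]

/-- The mean of `c` over the `n`-th block of length `Q`. -/
noncomputable def blockMean (c : ℕ → ℝ) (Q n : ℕ) : ℝ :=
  (∑ b ∈ Finset.range Q, c (Q * n + b)) / Q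

theorem blockMean_mul (c : ℕ → ℝ) (Q R n : ℕ) :
    blockMean c (Q * R) n = blockMean (blockMean c Q) R n := by
  unfold blockMean
  rw [sum_range_mul_eq_sum_blocks (fun i => c (Q * R * n + i)) Q R, ← Finset.sum_div, div_div]
  push_cast
  congr 1
  refine Finset.sum_congr rfl fun j _ => Finset.sum_congr rfl fun b _ => ?_
  congr 1
  ring

/-- If every block of length `R` meets a point where `f` takes the value `y`, then averaging over
the blocks contracts every interval that contains the values of `f`. -/
theorem blockMean_contract {f : ℕ → ℝ} {R : ℕ} {m ε y : ℝ} (hR : 0 < R)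
    (hf : ∀ n, m ≤ f n ∧ f n ≤ m + ε) (hy : ∀ n, ∃ b < R, f (R * n + b) = y) :
    ∃ m' : ℝ, ∀ n, m' ≤ blockMean f R n ∧ blockMean f R n ≤ m' + (1 - 1 / (R : ℝ)) * ε := by
  -- The least possible mean: one value is `y`, the other R - 1 equal `m`.
  refine ⟨(y + (R - 1) * m) / R, fun n => ?_⟩
  have hR' : (0 : ℝ) < R := by exact_mod_cast hR
  obtain ⟨b, hb, hby⟩ := hy n
  have hmem : b ∈ Finset.range R := Finset.mem_range.2 hb
  have hcard : (((Finset.range R).erase b).card : ℝ) = R - 1 := by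
    rw [Finset.card_erase_of_mem hmem, Finset.card_range, Nat.cast_sub hR, Nat.cast_one]
  have hsum := Finset.add_sum_erase (Finset.range R) (fun b => f (R * n + b)) hmem
  simp only [hby] at hsum
  have hlow := Finset.card_nsmul_le_sum ((Finset.range R).erase b) (fun b => f (R * n + b)) m
    fun i _ => (hf _).1
  have hupp := Finset.sum_le_card_nsmul ((Finset.range R).erase b) (fun b => f (R * n + b)) (m + ε)
    fun i _ => (hf _).2
  rw [nsmul_eq_mul, hcard] at hlow hupp
  have heq : (y + (R - 1) * m) / R + (1 - 1 / (R : ℝ)) * ε = (y + (R - 1) * (m + ε)) / R := by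
    field_simp
    ring
  rw [heq]
  unfold blockMean
  constructor
  · gcongr
    linarith
  · gcongr
    linarith

/-- Full blocks contribute the error `ε * N`; the incomplete last block contributes the rest. -/
theorem abs_sum_range_sub_le {c : ℕ → ℝ} (hc : ∀ n, 0 ≤ c n ∧ c n ≤ 1) {Q : ℕ} (hQ : 0 < Q)
    {m ε : ℝ} (hm : ∀ n, m ≤ blockMean c Q n ∧ blockMean c Q n ≤ m + ε) (N : ℕ) :
    |∑ i ∈ Finset.range N, c i - m * N| ≤ ε * N + (1 + |m|) * Q := by
  have hQ' : (0 : ℝ) < Q := by exact_mod_cast hQ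
  have hε : 0 ≤ ε := by linarith [(hm 0).1, (hm 0).2]
  have hN : Q * (N / Q) + N % Q = N := Nat.div_add_mod N Q
  have hr : ((N % Q : ℕ) : ℝ) ≤ Q := by exact_mod_cast (Nat.mod_lt N hQ).le
  have hr0 : (0 : ℝ) ≤ ((N % Q : ℕ) : ℝ) := Nat.cast_nonneg _
  have hNr : (Q : ℝ) * ((N / Q : ℕ) : ℝ) + ((N % Q : ℕ) : ℝ) = N := by exact_mod_cast hN
  have hsplit : ∑ i ∈ Finset.range N, c i
      = Q * ∑ j ∈ Finset.range (N / Q), blockMean c Q j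
        + ∑ b ∈ Finset.range (N % Q), c (Q * (N / Q) + b) := by
    conv_lhs => rw [← hN]
    rw [Finset.sum_range_add, sum_range_mul_eq_sum_blocks, Finset.mul_sum]
    congr 1
    refine Finset.sum_congr rfl fun j _ => ?_
    unfold blockMean
    field_simp
  have h1 := Finset.card_nsmul_le_sum (Finset.range (N / Q)) (blockMean c Q) m fun i _ => (hm i).1
  have h2 := Finset.sum_le_card_nsmul (Finset.range (N / Q)) (blockMean c Q) (m + ε)
    fun i _ => (hm i).2
  have h3 : 0 ≤ ∑ b ∈ Finset.range (N % Q), c (Q * (N / Q) + b) :=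
    Finset.sum_nonneg fun i _ => (hc _).1
  have h4 := Finset.sum_le_card_nsmul (Finset.range (N % Q)) (fun b => c (Q * (N / Q) + b)) 1
    fun i _ => (hc _).2
  rw [Finset.card_range, nsmul_eq_mul] at h1 h2 h4
  have h1' := mul_le_mul_of_nonneg_left h1 hQ'.le
  have h2' := mul_le_mul_of_nonneg_left h2 hQ'.le
  have h5 : |m * ((N % Q : ℕ) : ℝ)| ≤ |m| * Q := by
    rw [abs_mul, abs_of_nonneg hr0]
    gcongr
  have h6 : ε * (Q * ((N / Q : ℕ) : ℝ)) ≤ ε * N :=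
    mul_le_mul_of_nonneg_left (by linarith) hε
  have h7 : m * (N : ℝ) = Q * (((N / Q : ℕ) : ℝ) * m) + m * ((N % Q : ℕ) : ℝ) := by
    rw [← hNr]; ring
  have h8 : 0 ≤ ε * (N : ℝ) := mul_nonneg hε (Nat.cast_nonneg _)
  rw [hsplit, h7]
  have h9 := abs_le.1 h5
  rw [abs_le]
  constructor <;> nlinarith

theorem exists_tendsto_of_eventually_near {x : ℕ → ℝ}
    (h : ∀ ε > 0, ∃ m : ℝ, ∀ᶠ N in atTop, |x N - m| ≤ ε) : ∃ δ, Tendsto x atTop (𝓝 δ) := by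
  refine cauchySeq_tendsto_of_complete (Metric.cauchySeq_iff'.2 fun ε hε => ?_)
  obtain ⟨m, hm⟩ := h (ε / 3) (by positivity)
  obtain ⟨N, hN⟩ := eventually_atTop.1 hm
  refine ⟨N, fun n hn => ?_⟩
  have h1 := abs_le.1 (hN n hn)
  have h2 := abs_le.1 (hN N le_rfl)
  rw [Real.dist_eq, abs_lt]
  constructor <;> linarith [h1.1, h1.2, h2.1, h2.2]

theorem exists_tendsto_mean_of_blockMean {c : ℕ → ℝ} (hc : ∀ n, 0 ≤ c n ∧ c n ≤ 1)
    (h : ∀ ε > 0, ∃ Q > 0, ∃ m : ℝ, ∀ n, m ≤ blockMean c Q n ∧ blockMean c Q n ≤ m + ε) :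
    ∃ δ, Tendsto (fun N : ℕ => (∑ i ∈ Finset.range N, c i) / (N : ℝ)) atTop (𝓝 δ) := by
  refine exists_tendsto_of_eventually_near fun ε hε => ?_
  obtain ⟨Q, hQ, m, hm⟩ := h (ε / 2) (by positivity)
  have hlim : Tendsto (fun N : ℕ => (1 + |m|) * Q / (N : ℝ)) atTop (𝓝 0) :=
    tendsto_const_div_atTop_nhds_zero_nat _
  refine ⟨m, ?_⟩
  filter_upwards [hlim.eventually_lt_const (half_pos hε), eventually_gt_atTop 0] with N hN hN0
  have hN' : (0 : ℝ) < N := by exact_mod_cast hN0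
  have hb := abs_sum_range_sub_le hc hQ hm N
  have heq : (∑ i ∈ Finset.range N, c i) / (N : ℝ) - m
      = (∑ i ∈ Finset.range N, c i - m * N) / N := by
    field_simp
  rw [heq, abs_div, abs_of_pos hN', div_le_iff₀ hN']
  rw [div_lt_iff₀ hN'] at hN
  linarith

/-! ### Finite digit automata -/

section DigitAutomaton

variable {X : Type*} {q : ℕ} {g : ℕ → X}

theorem digit_append_congr (hq : 0 < q)
    (hg : ∀ n m r, r < q → g n = g m → g (q * n + r) = g (q * m + r)) (L : ℕ) :
    ∀ {n m b : ℕ}, b < q ^ L → g n = g m → g (q ^ L * n + b) = g (q ^ L * m + b) := by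
  induction L with
  | zero =>
    intro n m b hb h
    obtain rfl : b = 0 := by simpa using hb
    simpa using h
  | succ L ih =>
    intro n m b hb h
    have hb' : b / q < q ^ L := by
      rw [Nat.div_lt_iff_lt_mul hq, ← pow_succ]
      exact hb
    have key : ∀ a, q ^ (L + 1) * a + b = q * (q ^ L * a + b / q) + b % q := by
      intro a
      conv_lhs => rw [← Nat.div_add_mod b q]
      ring
    rw [key, key]
    exact hg _ _ _ (Nat.mod_lt _ hq) (ih hb' h)

/-- A common length of digit strings that lead from every state back to the initial one. -/
theorem exists_uniform_return [Finite X] (hq : 0 < q)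
    (hg : ∀ n m r, r < q → g n = g m → g (q * n + r) = g (q * m + r))
    (hret : ∀ n, ∃ L b, b < q ^ L ∧ g (q ^ L * n + b) = g 0) :
    ∃ K, ∀ n, ∃ b < q ^ K, g (q ^ K * n + b) = g 0 := by
  have hzero : ∀ j n, g n = g 0 → g (q ^ j * n) = g 0 := by
    intro j n h
    simpa using digit_append_congr hq hg j (b := 0) (by positivity) h
  -- A return of length `L` extends to every longer length, since appended zeros preserve the
  -- initial state; finitely many states then share a length.
  have hev : ∀ x : X, ∀ᶠ K in atTop, ∀ n, g n = x → ∃ b < q ^ K, g (q ^ K * n + b) = g 0 := by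
    intro x
    by_cases hx : ∃ n, g n = x
    · obtain ⟨n, rfl⟩ := hx
      obtain ⟨L, b, hb, h⟩ := hret n
      filter_upwards [eventually_ge_atTop L] with K hK n' hn'
      obtain ⟨j, rfl⟩ := Nat.exists_eq_add_of_le hK
      refine ⟨q ^ j * b, ?_, ?_⟩
      · rw [pow_add, mul_comm]
        exact Nat.mul_lt_mul_of_pos_right hb (by positivity)
      · have h' := hzero j _ ((digit_append_congr hq hg L hb hn').trans h)
        rw [← h']
        congr 1
        ring
    · exact Eventually.of_forall fun K n hn => (hx ⟨n, hn⟩).elim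
  obtain ⟨K, hK⟩ := (eventually_all.2 hev).exists
  exact ⟨K, fun n => hK _ n rfl⟩

/-- A set of natural numbers that is recognized by a finite digit automaton (most significant
digit first) all of whose states lead back to the initial one has a density. -/
theorem exists_density_of_digit_automaton [Finite X] (hq : 0 < q)
    (hg : ∀ n m r, r < q → g n = g m → g (q * n + r) = g (q * m + r))
    (hret : ∀ n, ∃ L b, b < q ^ L ∧ g (q ^ L * n + b) = g 0)
    (P : ℕ → Prop) [DecidablePred P] (hP : ∀ n m, g n = g m → (P n ↔ P m)) :
    ∃ δ : ℝ, Tendsto (fun N : ℕ => (((Finset.range N).filter P).card : ℝ) / (N : ℝ))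
      atTop (𝓝 δ) := by
  obtain ⟨K, hK⟩ := exists_uniform_return hq hg hret
  set c : ℕ → ℝ := fun n => if P n then 1 else 0 with hcdef
  have hc : ∀ n, 0 ≤ c n ∧ c n ≤ 1 := by
    intro n
    simp only [hcdef]
    split_ifs <;> norm_num
  have hmean : ∀ k n m, g n = g m → blockMean c (q ^ k) n = blockMean c (q ^ k) m := by
    intro k n m h
    unfold blockMean
    congr 1
    refine Finset.sum_congr rfl fun b hb => ?_
    have := hP _ _ (digit_append_congr hq hg k (Finset.mem_range.1 hb) h)
    simp only [hcdef, this]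
  have hR : 0 < q ^ K := by positivity
  have hR' : (1 : ℝ) ≤ ((q ^ K : ℕ) : ℝ) := by exact_mod_cast hR
  set ρ : ℝ := 1 - 1 / ((q ^ K : ℕ) : ℝ) with hρ
  have hρ0 : 0 ≤ ρ := by
    rw [hρ, sub_nonneg, div_le_one (by linarith)]
    exact hR'
  have hρ1 : ρ < 1 := by
    have : 0 < 1 / ((q ^ K : ℕ) : ℝ) := by positivity
    linarith
  have hiter : ∀ j : ℕ, ∃ m : ℝ, ∀ n, m ≤ blockMean c (q ^ (K * j)) n ∧
      blockMean c (q ^ (K * j)) n ≤ m + ρ ^ j := by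
    intro j
    induction j with
    | zero => exact ⟨0, fun n => by simpa [blockMean] using hc n⟩
    | succ j ih =>
      obtain ⟨m, hm⟩ := ih
      obtain ⟨m', hm'⟩ := blockMean_contract (y := blockMean c (q ^ (K * j)) 0) hR hm fun n => by
        obtain ⟨b, hb, h⟩ := hK n
        exact ⟨b, hb, hmean _ _ _ h⟩
      refine ⟨m', fun n => ?_⟩
      rw [Nat.mul_succ, pow_add, blockMean_mul, pow_succ' ρ]
      exact hm' n
  have hlim := exists_tendsto_mean_of_blockMean hc fun ε hε => by
    obtain ⟨j, hj⟩ := exists_pow_lt_of_lt_one hε hρ1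
    obtain ⟨m, hm⟩ := hiter j
    exact ⟨q ^ (K * j), by positivity, m, fun n => ⟨(hm n).1, (hm n).2.trans (by linarith)⟩⟩
  simpa [hcdef, Finset.sum_boole] using hlim

end DigitAutomaton

/-! ### Digit recursions -/

theorem vq_eq_zero_of_not_dvd {q n : ℕ} (h : ¬ q ∣ n) : vq q n = 0 :=
  padicValNat.eq_zero_of_not_dvd h

/-- For composite `q` the valuation need not be additive, so maximality of the exponent is used
directly. -/
theorem vq_mul_self {q n : ℕ} (hq : 2 ≤ q) (hn : 0 < n) : vq q (q * n) = vq q n + 1 := by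
  refine (vq_isGreatest hq (by positivity)).unique ⟨?_, fun k hk => ?_⟩
  · rw [Set.mem_ofPred_eq, pow_succ']
    exact mul_dvd_mul_left q (vq_isGreatest hq hn).1
  · cases k with
    | zero => omega
    | succ k =>
      rw [Set.mem_ofPred_eq, pow_succ'] at hk
      have := (vq_isGreatest hq hn).2 (Nat.dvd_of_mul_dvd_mul_left (by omega) hk)
      omega

theorem wq_zero (q : ℕ) : wq q 0 = 0 := by simp [wq, vq_zero]

theorem wq_succ (q n : ℕ) : wq q (n + 1) = wq q n + vq q (n + 1) :=
  Finset.sum_range_succ _ _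

theorem uq_zero (q : ℕ) : uq q 0 = 0 := by simp [uq, wq_zero]

theorem uq_succ (q n : ℕ) : uq q (n + 1) = uq q n + wq q (n + 1) :=
  Finset.sum_range_succ _ _

/-- No multiple of `q` lies strictly between `q * n` and `q * (n + 1)`. The hypothesis `h` lets this
serve inside the induction for `wq_mul`. -/
theorem wq_mul_add_of_wq_mul {q n : ℕ} (h : wq q (q * n) = n + wq q n) (r : ℕ) (hr : r < q) :
    wq q (q * n + r) = n + wq q n := by
  induction r with
  | zero => simpa using h
  | succ r ih =>
    rw [← add_assoc, wq_succ, ih (by omega), vq_eq_zero_of_not_dvd, add_zero]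
    rw [add_assoc, Nat.dvd_add_right (dvd_mul_right q n)]
    exact fun h' => absurd (Nat.le_of_dvd (by omega) h') (by omega)

theorem wq_mul {q : ℕ} (hq : 2 ≤ q) (n : ℕ) : wq q (q * n) = n + wq q n := by
  induction n with
  | zero => simp [wq_zero]
  | succ n ih =>
    have h := wq_mul_add_of_wq_mul ih (q - 1) (by omega)
    have e : q * (n + 1) = q * n + (q - 1) + 1 := by
      rw [Nat.mul_succ]
      omega
    have hv := vq_mul_self hq (Nat.succ_pos n)
    rw [Nat.succ_eq_add_one] at hv
    rw [e, wq_succ, h, ← e, hv, wq_succ]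
    ring

theorem wq_mul_add {q : ℕ} (hq : 2 ≤ q) (n : ℕ) {r : ℕ} (hr : r < q) :
    wq q (q * n + r) = n + wq q n :=
  wq_mul_add_of_wq_mul (wq_mul hq n) r hr

/-- Under concatenation of digit strings w is additive up to a multiple of a repunit, which is what
makes repeated copies of `n` computable. -/
theorem wq_pow_mul_add {q : ℕ} (hq : 2 ≤ q) (L : ℕ) :
    ∀ {a b : ℕ}, b < q ^ L →
      wq q (q ^ L * a + b) = wq q b + (wq q a + a * ∑ i ∈ Finset.range L, q ^ i) := by
  have hq0 : 0 < q := by omega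
  induction L with
  | zero =>
    intro a b hb
    obtain rfl : b = 0 := by simpa using hb
    simp [wq_zero]
  | succ L ih =>
    intro a b hb
    have hb' : b / q < q ^ L := by
      rw [Nat.div_lt_iff_lt_mul hq0, ← pow_succ]
      exact hb
    have key : q ^ (L + 1) * a + b = q * (q ^ L * a + b / q) + b % q := by
      conv_lhs => rw [← Nat.div_add_mod b q]
      ring
    have hwb : wq q b = b / q + wq q (b / q) := by
      conv_lhs => rw [← Nat.div_add_mod b q]
      exact wq_mul_add hq _ (Nat.mod_lt _ hq0)
    rw [key, wq_mul_add hq _ (Nat.mod_lt _ hq0), ih hb', hwb, Finset.sum_range_succ]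
    ring

theorem triangle_succ (n : ℕ) : (n + 1) * (n + 1 + 1) / 2 = n * (n + 1) / 2 + (n + 1) := by
  have : (n + 1) * (n + 1 + 1) = n * (n + 1) + (n + 1) * 2 := by ring
  rw [this, Nat.add_mul_div_right _ _ (by norm_num)]

theorem two_mul_triangle (n : ℕ) : 2 * ((n * (n + 1) / 2 : ℕ) : ℤ) = n * (n + 1) := by
  exact_mod_cast Nat.mul_div_cancel' (Nat.even_mul_succ_self n).two_dvd

theorem exists_triangle_mul_add (q r : ℕ) : ∃ e : ℤ, ∀ n : ℕ,
    (((q * n + r) * (q * n + r + 1) / 2 : ℕ) : ℤ)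
      = q ^ 2 * ((n * (n + 1) / 2 : ℕ) : ℤ) + e * n + ((r * (r + 1) / 2 : ℕ) : ℤ) := by
  -- The coefficient is e = q(2r + 1 - q)/2; the two factors have opposite parity.
  have heven : Even ((q : ℤ) * (2 * r + 1 - q)) := by
    rcases Int.even_or_odd (q : ℤ) with h | h
    · exact h.mul_right _
    · exact Even.mul_left ((odd_two_mul_add_one (r : ℤ)).sub_odd h) _
  obtain ⟨e, he⟩ := heven
  refine ⟨e, fun n => ?_⟩
  have h1 := two_mul_triangle (q * n + r)
  have h2 := two_mul_triangle n
  have h3 := two_mul_triangle r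
  rw [Nat.cast_add, Nat.cast_mul] at h1
  have : (2 : ℤ) * (((q * n + r) * (q * n + r + 1) / 2 : ℕ) : ℤ)
      = 2 * (q ^ 2 * ((n * (n + 1) / 2 : ℕ) : ℤ) + e * n + ((r * (r + 1) / 2 : ℕ) : ℤ)) := by
    linear_combination h1 - (q : ℤ) ^ 2 * h2 - h3 + (n : ℤ) * he
  linarith

/-- On each block of length `q`, w is constant, equal to i + w(i). The first term sums the full
blocks i < n, the second the r + 1 terms of block `n`. -/
theorem uq_mul_add_of_uq_mul {q n : ℕ} (hq : 2 ≤ q)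
    (h : (uq q (q * n) : ℤ) = q * (((n * (n + 1) / 2 : ℕ) : ℤ) + uq q n - n - wq q n)
      + (n + wq q n)) (r : ℕ) (hr : r < q) :
    (uq q (q * n + r) : ℤ) = q * (((n * (n + 1) / 2 : ℕ) : ℤ) + uq q n - n - wq q n)
      + (r + 1) * (n + wq q n) := by
  induction r with
  | zero => simpa using h
  | succ r ih =>
    rw [← add_assoc, uq_succ, Nat.cast_add, ih (by omega), add_assoc (q * n), wq_mul_add hq n hr]
    push_cast
    ring

theorem uq_mul {q : ℕ} (hq : 2 ≤ q) (n : ℕ) :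
    (uq q (q * n) : ℤ) = q * (((n * (n + 1) / 2 : ℕ) : ℤ) + uq q n - n - wq q n)
      + (n + wq q n) := by
  induction n with
  | zero => simp [uq_zero, wq_zero]
  | succ n ih =>
    have h := uq_mul_add_of_uq_mul hq ih (q - 1) (by omega)
    have e : q * (n + 1) = q * n + (q - 1) + 1 := by
      rw [Nat.mul_succ]
      omega
    rw [Nat.cast_sub (by omega : 1 ≤ q)] at h
    rw [e, uq_succ, Nat.cast_add, h, ← e, wq_mul hq, triangle_succ, uq_succ]
    push_cast
    ring

theorem uq_mul_add {q : ℕ} (hq : 2 ≤ q) (n : ℕ) {r : ℕ} (hr : r < q) :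
    (uq q (q * n + r) : ℤ) = q * (((n * (n + 1) / 2 : ℕ) : ℤ) + uq q n - n - wq q n)
      + (r + 1) * (n + wq q n) :=
  uq_mul_add_of_uq_mul hq (uq_mul hq n) r hr

/-! ### The residues modulo `d` as a digit automaton -/

/-- The residues modulo `d` of `w_q(n)` and `n`. -/
def linearState (q d n : ℕ) : ZMod d × ZMod d := ((wq q n : ZMod d), (n : ZMod d))

/-- The residues modulo `d` of `u_q(n)`, `w_q(n)`, `n (n + 1) / 2` and `n`. -/
def fullState (q d n : ℕ) : (ZMod d × ZMod d) × (ZMod d × ZMod d) :=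
  (((uq q n : ZMod d), ((n * (n + 1) / 2 : ℕ) : ZMod d)), linearState q d n)

theorem linearState_congr {q d : ℕ} (hq : 2 ≤ q) (n m r : ℕ) (hr : r < q)
    (h : linearState q d n = linearState q d m) :
    linearState q d (q * n + r) = linearState q d (q * m + r) := by
  simp only [linearState, Prod.mk.injEq] at h ⊢
  rw [wq_mul_add hq n hr, wq_mul_add hq m hr]
  push_cast
  rw [h.1, h.2]
  exact ⟨rfl, rfl⟩

theorem fullState_congr {q d : ℕ} (hq : 2 ≤ q) (n m r : ℕ) (hr : r < q)
    (h : fullState q d n = fullState q d m) :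
    fullState q d (q * n + r) = fullState q d (q * m + r) := by
  have hl := linearState_congr hq n m r hr (congrArg Prod.snd h)
  obtain ⟨e, he⟩ := exists_triangle_mul_add q r
  have hT : ∀ k : ℕ, (((q * k + r) * (q * k + r + 1) / 2 : ℕ) : ZMod d)
      = q ^ 2 * ((k * (k + 1) / 2 : ℕ) : ZMod d) + e * k + ((r * (r + 1) / 2 : ℕ) : ZMod d) := by
    intro k
    have h := congrArg (Int.cast : ℤ → ZMod d) (he k)
    simpa only [Int.cast_add, Int.cast_mul, Int.cast_pow, Int.cast_natCast] using h
  have hU : ∀ k : ℕ, (uq q (q * k + r) : ZMod d)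
      = q * (((k * (k + 1) / 2 : ℕ) : ZMod d) + uq q k - k - wq q k) + (r + 1) * (k + wq q k) := by
    intro k
    exact_mod_cast congrArg (Int.cast : ℤ → ZMod d) (uq_mul_add hq k hr)
  simp only [fullState, linearState, Prod.mk.injEq] at h
  obtain ⟨⟨h1, h2⟩, h3, h4⟩ := h
  rw [fullState, fullState, hl, hT, hT, hU, hU, h1, h2, h3, h4]

/-- Concatenating `d` copies of `n`, at places where `q ^ l` and `1 + q + ⋯ + q ^ (l - 1)` have
fixed residues, leads back to the initial state. -/
theorem linearState_return {q d : ℕ} (hq : 2 ≤ q) (hd : 0 < d) (n : ℕ) :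
    ∃ L b, b < q ^ L ∧ linearState q d (q ^ L * n + b) = linearState q d 0 := by
  have : NeZero d := ⟨hd.ne'⟩
  let f : ℕ → ZMod d × ZMod d := fun l =>
    (((q ^ l : ℕ) : ZMod d), ((∑ i ∈ Finset.range l, q ^ i : ℕ) : ZMod d))
  -- Infinitely many places share these residues, so one can always be chosen beyond the digits
  -- already written.
  obtain ⟨⟨y, z⟩, hy⟩ := Finite.exists_infinite_fiber f
  have hy' : (f ⁻¹' {(y, z)}).Infinite := Set.infinite_coe_iff.1 hy
  have hstep : ∀ b : ℕ, ∃ l, b < q ^ l ∧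
      ((q ^ l * n + b : ℕ) : ZMod d) = b + y * n ∧
      (wq q (q ^ l * n + b) : ZMod d) = wq q b + (wq q n + n * z) := by
    intro b
    obtain ⟨l, hl, hbl⟩ := hy'.exists_gt b
    have hbq : b < q ^ l := hbl.trans (Nat.lt_pow_self (by omega))
    have hl' : f l = (y, z) := hl
    simp only [f, Prod.mk.injEq] at hl'
    refine ⟨l, hbq, ?_, ?_⟩
    · rw [Nat.cast_add, Nat.cast_mul, hl'.1, add_comm]
    · rw [wq_pow_mul_add hq l hbq, Nat.cast_add, Nat.cast_add, Nat.cast_mul, hl'.2]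
  have hmany : ∀ k : ℕ, ∃ b : ℕ, (b : ZMod d) = k * (y * n) ∧
      (wq q b : ZMod d) = k * (wq q n + n * z) := by
    intro k
    induction k with
    | zero => exact ⟨0, by simp, by simp [wq_zero]⟩
    | succ k ih =>
      obtain ⟨b, h1, h2⟩ := ih
      obtain ⟨l, -, h3, h4⟩ := hstep b
      refine ⟨q ^ l * n + b, ?_, ?_⟩
      · rw [h3, h1]
        push_cast
        ring
      · rw [h4, h2]
        push_cast
        ring
  -- The `d`-th copy of `n` is the leading one in `q ^ l * n + b`.
  obtain ⟨b, h1, h2⟩ := hmany (d - 1)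
  obtain ⟨l, hb, h3, h4⟩ := hstep b
  have hd1 : ((d - 1 : ℕ) : ZMod d) = -1 := by
    rw [Nat.cast_sub hd, ZMod.natCast_self]
    simp
  refine ⟨l, b, hb, ?_⟩
  simp only [linearState, Prod.mk.injEq, wq_zero]
  rw [h3, h4, h1, h2, hd1]
  constructor <;> push_cast <;> ring

theorem fullState_return {q d : ℕ} (hq : 2 ≤ q) (hd : 0 < d) (hdq : ∃ k, d ∣ q ^ k) (n : ℕ) :
    ∃ L b, b < q ^ L ∧ fullState q d (q ^ L * n + b) = fullState q d 0 := by
  obtain ⟨k, hk⟩ := hdq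
  obtain ⟨L, b, hb, h⟩ := linearState_return hq hd n
  have hzero : ∀ j, linearState q d (q ^ j * (q ^ L * n + b)) = linearState q d 0 := by
    intro j
    simpa using digit_append_congr (by omega) (linearState_congr hq) j (b := 0)
      (by positivity) h
  have hdvd : ∀ j, ∃ x y : ZMod d, (uq q (q ^ j * (q ^ L * n + b)) : ZMod d) = q ^ j * x ∧
      ((q ^ j * (q ^ L * n + b) * (q ^ j * (q ^ L * n + b) + 1) / 2 : ℕ) : ZMod d)
        = q ^ j * y := by
    intro j
    induction j with
    | zero => exact ⟨_, _, by rw [pow_zero, one_mul, pow_zero, one_mul],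
        by rw [pow_zero, one_mul, pow_zero, one_mul]⟩
    | succ j ih =>
      obtain ⟨x, y, hx, hy⟩ := ih
      have hz := hzero j
      rw [pow_succ', mul_assoc q]
      set M := q ^ j * (q ^ L * n + b)
      simp only [linearState, Prod.mk.injEq, wq_zero, Nat.cast_zero] at hz
      obtain ⟨e, he⟩ := exists_triangle_mul_add q 0
      have hT := congrArg (Int.cast : ℤ → ZMod d) (he M)
      have hU := congrArg (Int.cast : ℤ → ZMod d) (uq_mul hq M)
      simp only [add_zero, Int.cast_add, Int.cast_sub, Int.cast_mul, Int.cast_pow,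
        Int.cast_natCast] at hT hU
      rw [hz.2, hy] at hT
      rw [hz.1, hz.2, hx, hy] at hU
      -- With w and n zero modulo `d`, the recursions reduce to u ↦ q(T + u) and T ↦ q²T, where T =
      -- n(n+1)/2.
      refine ⟨y + x, q * y, ?_, ?_⟩
      · rw [hU]
        ring
      · rw [hT]
        simp
        ring
  have hqk : (q : ZMod d) ^ k = 0 := by
    rw [← Nat.cast_pow]
    exact (ZMod.natCast_eq_zero_iff _ _).2 hk
  obtain ⟨x, y, hx, hy⟩ := hdvd k
  rw [hqk, zero_mul] at hx hy
  have e : q ^ (L + k) * n + q ^ k * b = q ^ k * (q ^ L * n + b) := by ring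
  refine ⟨L + k, q ^ k * b, ?_, ?_⟩
  · rw [pow_add, mul_comm]
    exact Nat.mul_lt_mul_of_pos_right hb (by positivity)
  · rw [e, fullState, fullState, hzero, hx, hy]
    simp [uq_zero]

/-! ### Solutions in terms of states, and their densities -/

theorem isSolution_iff (q d : ℕ) (s : Fin 5 → ℤ) (n : ℕ) :
    IsSolution q d s n ↔ (s 0 : ZMod d) * (uq q n : ZMod d) + (s 1 : ZMod d) * (wq q n : ZMod d)
      + (s 2 : ZMod d) * ((n * (n + 1) / 2 : ℕ) : ZMod d) + (s 3 : ZMod d) * (n : ZMod d)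
      + (s 4 : ZMod d) = 0 := by
  rw [IsSolution, ← ZMod.intCast_eq_intCast_iff]
  simp only [Int.cast_add, Int.cast_mul, Int.cast_natCast, Int.cast_zero]

theorem solutionCount_congr {q d : ℕ} {s t : Fin 5 → ℤ} (h : ∀ i, (s i : ZMod d) = t i) (N : ℕ) :
    solutionCount N q d s = solutionCount N q d t := by
  unfold solutionCount
  congr 1
  refine Finset.filter_congr fun n _ => ?_
  simp only [isSolution_iff, h]

theorem exists_density_linear {q d : ℕ} (hq : 2 ≤ q) (hd : 0 < d) (θw θ1 θ0 : ℤ) :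
    ∃ δ : ℝ, HasSolutionDensity q d ![0, θw, 0, θ1, θ0] δ := by
  have : NeZero d := ⟨hd.ne'⟩
  refine exists_density_of_digit_automaton (by omega) (linearState_congr (d := d) hq)
    (linearState_return hq hd) _ fun n m h => ?_
  simp only [linearState, Prod.mk.injEq] at h
  simp [isSolution_iff, h.1, h.2]

theorem exists_density_full {q d : ℕ} (hq : 2 ≤ q) (hd : 0 < d) (hdq : ∃ k, d ∣ q ^ k)
    (s : Fin 5 → ℤ) : ∃ δ : ℝ, HasSolutionDensity q d s δ := by
  have : NeZero d := ⟨hd.ne'⟩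
  refine exists_density_of_digit_automaton (by omega) (fullState_congr (d := d) hq)
    (fullState_return hq hd hdq) _ fun n m h => ?_
  simp only [fullState, linearState, Prod.mk.injEq] at h
  obtain ⟨⟨h1, h2⟩, h3, h4⟩ := h
  rw [isSolution_iff, isSolution_iff, h1, h2, h3, h4]

theorem mainTheorem5 (q d : ℕ) (hq : 2 ≤ q) (hd : 2 ≤ d) :
    (∀ θw θ1 θ0 : ℤ, ∃ δ : ℝ, HasSolutionDensity q d ![0, θw, 0, θ1, θ0] δ) ∧
    ((∃ n : ℕ, d ∣ q ^ n) → ∃ δ : (Fin 5 → ZMod d) → ℝ, HasDensityVector q d δ) := by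
  refine ⟨exists_density_linear hq (by omega), fun hdq => ?_⟩
  choose δ hδ using exists_density_full hq (by omega) hdq
  -- Each residue vector gets the density of its canonical integer representative.
  refine ⟨fun t => δ fun i => (t i).cast, fun s => ?_⟩
  have h := hδ fun i => ((s i : ZMod d).cast : ℤ)
  unfold HasSolutionDensity at h ⊢
  simpa only [solutionCount_congr (s := s) (t := fun i => ((s i : ZMod d).cast : ℤ))
    fun i => (ZMod.intCast_zmod_cast _).symm] using h
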